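/- Let $\Omega\subset\mathbb{R}^n$ be open, let $k\ge 1$ be an integer, and write $D_l=-i\,\partial_{x_l}$. Consider on $\Omega$ the operator $$P=\sum_{j=1}^N X_j^*\,f^{2k}\,X_j+iX_0+a_0,$$ where $X_j=\sum_{l=1}^n c_{jl}(x)D_l$ $(1\le j\le N)$ with coefficients $c_{jl}\in C^\infty(\Omega;\mathbb{C})$ (in particular, real coefficients are allowed), $X_0=\sum_{l=1}^n b_l(x)D_l$ with real coefficients $b_l\in C^\infty(\Omega;\mathbb{R})$ (so that $iX_0=\sum_l b_l\,\partial_{x_l}$ is a real vector field), $a_0\in C^\infty(\Omega;\mathbb{C})$, $f\in C^\infty(\Omega;\mathbb{R})$, and $X_j^*$ is the formal $L^2$-adjoint of $X_j$. Let $S=\{x\in\Omega: f(x)=0\}$ and assume that $iX_0f\neq 0$ at every point of $S$. Then $P$ is $L^2$ to $L^2$ locally solvable at every point of $S$: for every $x_0\in S$ there is a compact set $K\subset\Omega$ with $x_0$ in its interior $U=\mathring{K}$ such that for every $v\in L^2_{\mathrm{loc}}(\Omega)$ there is $u\in L^2_{\mathrm{loc}}(\Omega)$ solving $Pu=v$ in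 $U$ in the sense of distributions, i.e. $\int_U u\,\overline{P^*\varphi}\,dx=\int_U v\,\overline{\varphi}\,dx$ for all $\varphi\in C_0^\infty(U)$, where $P^*$ is the formal $L^2$-adjoint of $P$. -/

import Mathlib

open scoped ContDiff

noncomputable section

/-- Scalar linear partial differential operators on (a subset of) `ℝⁿ`, as expressions built from
multiplication operators and the derivatives `D_l = -i ∂_l`. -/
inductive DiffOp (n : ℕ) : Type
  | /-- multiplication by a complex-valued function -/
    mul (a : EuclideanSpace ℝ (Fin n) → ℂ) : DiffOp n
  | /-- the operator `D_l = -i ∂_l` -/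
    D (l : Fin n) : DiffOp n
  | /-- composition: `comp A B` is `u ↦ A (B u)` -/
    comp (A B : DiffOp n) : DiffOp n
  | /-- sum of two operators -/
    add (A B : DiffOp n) : DiffOp n
  | /-- finite sum of operators -/
    sum (m : ℕ) (A : Fin m → DiffOp n) : DiffOp n

namespace DiffOp

variable {n : ℕ}

/-- The (pointwise) action of a differential operator on a function. -/
def apply : DiffOp n → (EuclideanSpace ℝ (Fin n) → ℂ) → EuclideanSpace ℝ (Fin n) → ℂ
  | mul a, u => fun x => a x * u x
  | D l, u => fun x => -Complex.I * fderiv ℝ u x (EuclideanSpace.single l 1)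
  | comp A B, u => A.apply (B.apply u)
  | add A B, u => fun x => A.apply u x + B.apply u x
  | sum m A, u => fun x => ∑ j : Fin m, (A j).apply u x

/-- The formal adjoint with respect to the `L²` product `(u, v) = ∫ u (conj v)`:
`a* = conj a`, `D_l* = D_l`, `(A B)* = B* A*`, and the adjoint of a sum is the sum of the
adjoints. -/
def adjoint : DiffOp n → DiffOp n
  | mul a => mul fun x => starRingEnd ℂ (a x)
  | D l => D l
  | comp A B => comp B.adjoint A.adjoint
  | add A B => add A.adjoint B.adjoint
  | sum m A => sum m fun j => (A j).adjoint

/-- The homogeneous first order operator `X(x, D) = ∑_l c_l(x) D_l`. -/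
def firstOrder (c : Fin n → EuclideanSpace ℝ (Fin n) → ℂ) : DiffOp n :=
  sum n fun l => comp (mul (c l)) (D l)

/-- The operator `P = ∑_{j=1}^N X_j* f^p X_j + i X_0 + a_0`, where
`X_j = ∑_l c_{jl} D_l` (complex coefficients) for `j = 1, …, N`, and `X_0 = ∑_l b_l D_l` with real
coefficients (that is, `i X_0 = ∑_l b_l ∂_l` is a real vector field). -/
def mainClass {N : ℕ} (p : ℕ) (c : Fin N → Fin n → EuclideanSpace ℝ (Fin n) → ℂ)
    (b : Fin n → EuclideanSpace ℝ (Fin n) → ℝ) (a₀ : EuclideanSpace ℝ (Fin n) → ℂ)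
    (f : EuclideanSpace ℝ (Fin n) → ℝ) : DiffOp n :=
  add
    (add
      (sum N fun j =>
        comp (firstOrder (c j)).adjoint
          (comp (mul fun x => ((f x ^ p : ℝ) : ℂ)) (firstOrder (c j))))
      (comp (mul fun _ => Complex.I) (firstOrder fun l x => (b l x : ℂ))))
    (mul a₀)

end DiffOp

/-- `u ∈ L²_loc(Ω)`. -/
def MemL2Loc {n : ℕ} (Ω : Set (EuclideanSpace ℝ (Fin n))) (u : EuclideanSpace ℝ (Fin n) → ℂ) :
    Prop :=
  ∀ K : Set (EuclideanSpace ℝ (Fin n)), IsCompact K → K ⊆ Ω →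
    MeasureTheory.MemLp u 2 (MeasureTheory.volume.restrict K)

/-- `φ ∈ C_0^∞(U)`. -/
def IsTestFunction {n : ℕ} (U : Set (EuclideanSpace ℝ (Fin n)))
    (φ : EuclideanSpace ℝ (Fin n) → ℂ) : Prop :=
  ContDiff ℝ ∞ φ ∧ HasCompactSupport φ ∧ tsupport φ ⊆ U

/-- `P u = v` in the open set `U`, in the sense of distributions:
`(u, P* φ) = (v, φ)` for all `φ ∈ C_0^∞(U)`. -/
def SolvesIn {n : ℕ} (P : DiffOp n) (U : Set (EuclideanSpace ℝ (Fin n)))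
    (u v : EuclideanSpace ℝ (Fin n) → ℂ) : Prop :=
  ∀ φ : EuclideanSpace ℝ (Fin n) → ℂ, IsTestFunction U φ →
    ∫ x in U, u x * starRingEnd ℂ (P.adjoint.apply φ x) = ∫ x in U, v x * starRingEnd ℂ (φ x)

/-- `L²` to `L²` local solvability of `P` at the point `x₀` of the open set `Ω`. -/
def L2LocallySolvableAt {n : ℕ} (Ω : Set (EuclideanSpace ℝ (Fin n))) (P : DiffOp n)
    (x₀ : EuclideanSpace ℝ (Fin n)) : Prop :=
  ∃ K : Set (EuclideanSpace ℝ (Fin n)), IsCompact K ∧ K ⊆ Ω ∧ x₀ ∈ interior K ∧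
    ∀ v, MemL2Loc Ω v → ∃ u, MemL2Loc Ω u ∧ SolvesIn P (interior K) u v

end

/-!
Solvability in `L²` near a zero `x₀` of `f` is dual to the a priori estimate `‖φ‖ ≤ C ‖P* φ‖` for
test functions `φ` supported near `x₀`: by Hahn–Banach and the Riesz representation theorem, the
functional `P* φ ↦ (φ, v)` is then represented by some `u` in `L²`
(`exists_inner_eq_of_norm_le`, `L2LocallySolvableAt.of_estimate`).

The estimate comes from pairing `P* φ` with `w φ`, where `w = 1 + t f` is a real weight. Write
`V = i X₀` for the real vector field. Integration by parts shows that the transport part contributes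
`½ ∫ (V w - w div V) |φ|²`, with no derivative of `φ` left. The second order part contributes
`∑ ∫ f^{2k} Re (X_j φ · conj (w X_j φ + (X_j w) φ))`, and completing the square bounds this from
below by `-½ ∑ ∫ f^{2k} |X_j w|² |φ|²` as long as `w ≥ ½`. Hence `Re (P* φ, w φ) ≥ ∫ q |φ|²` with
`q` the function `DiffOp.energyDensity` (`DiffOp.integral_norm_sq_le_re_adjoint`).

At `x₀` the weight is `1`, the loss from the second order part vanishes because of the factor
`f^{2k}`, and `V w = t V f` with `V f ≠ 0`. So `t` can be chosen to make `q x₀ = 2`, whatever the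
values of `div V` and `a₀`; by continuity `q ≥ 1` and `½ ≤ w ≤ 2` on a small ball around `x₀`, and
this ball is the neighbourhood on which the equation is solved (`DiffOp.integral_norm_sq_le`).
-/

section

open scoped ContDiff
open MeasureTheory Complex

/-! ### Solving an adjoint equation in a Hilbert space -/

/-- If `‖L φ‖ ≤ C ‖T φ‖` for all `φ`, then `L` factors through `T` as the inner product with some
vector. -/
theorem exists_inner_eq_of_norm_le {E H : Type*} [AddCommGroup E] [Module ℂ E]
    [NormedAddCommGroup H] [InnerProductSpace ℂ H] [CompleteSpace H]
    (T : E →ₗ[ℂ] H) (L : E →ₗ[ℂ] ℂ) (C : ℝ) (h : ∀ φ, ‖L φ‖ ≤ C * ‖T φ‖) :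
    ∃ u : H, ∀ φ, inner ℂ u (T φ) = L φ := by
  obtain ⟨g, hg, -⟩ := exists_extension_norm_eq (LinearMap.range T) (L.compLeftInverse T)
  refine ⟨(InnerProductSpace.toDual ℂ H).symm g, fun φ => ?_⟩
  rw [InnerProductSpace.toDual_symm_apply]
  have := hg ⟨T φ, φ, rfl⟩
  rw [this]
  exact LinearMap.compLeftInverse_apply_of_bdd _ _ ⟨C, h⟩ _ _ rfl

/-! ### Test functions -/

namespace IsTestFunction

variable {n : ℕ} {U : Set (EuclideanSpace ℝ (Fin n))} {φ ψ : EuclideanSpace ℝ (Fin n) → ℂ}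

theorem eq_zero (h : IsTestFunction U φ) {x : EuclideanSpace ℝ (Fin n)} (hx : x ∉ U) : φ x = 0 :=
  image_eq_zero_of_notMem_tsupport fun hx' => hx (h.2.2 hx')

theorem differentiable (h : IsTestFunction U φ) : Differentiable ℝ φ :=
  h.1.differentiable (by simp)

theorem memLp (h : IsTestFunction U φ) (μ : Measure (EuclideanSpace ℝ (Fin n)))
    [IsFiniteMeasureOnCompacts μ] : MemLp φ 2 μ :=
  h.1.continuous.memLp_of_hasCompactSupport h.2.1

theorem integrable (h : IsTestFunction U φ) : Integrable φ :=
  h.1.continuous.integrable_of_hasCompactSupport h.2.1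

theorem zero : IsTestFunction U (0 : EuclideanSpace ℝ (Fin n) → ℂ) :=
  ⟨contDiff_const, HasCompactSupport.zero, by simp [tsupport]⟩

theorem add (h : IsTestFunction U φ) (h' : IsTestFunction U ψ) :
    IsTestFunction U (fun x => φ x + ψ x) :=
  ⟨h.1.add h'.1, h.2.1.add h'.2.1, (tsupport_add φ ψ).trans (Set.union_subset h.2.2 h'.2.2)⟩

theorem sum {m : ℕ} {φ : Fin m → EuclideanSpace ℝ (Fin n) → ℂ}
    (h : ∀ j, IsTestFunction U (φ j)) : IsTestFunction U (fun x => ∑ j, φ j x) := by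
  have key : ∀ s : Finset (Fin m), IsTestFunction U (fun x => ∑ j ∈ s, φ j x) := by
    intro s
    induction s using Finset.induction_on with
    | empty => exact zero
    | insert a s ha ih => simpa [Finset.sum_insert ha] using (h a).add ih
  exact key _

/-- The coefficient need be smooth only on `U`: its values outside play no role. -/
theorem mul_left (hU : IsOpen U) {a : EuclideanSpace ℝ (Fin n) → ℂ} (ha : ContDiffOn ℝ ∞ a U)
    (h : IsTestFunction U φ) : IsTestFunction U (fun x => a x * φ x) := by
  have hs : tsupport (fun x => a x * φ x) ⊆ tsupport φ := tsupport_mul_subset_right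
  refine ⟨contDiff_iff_contDiffAt.2 fun x => ?_, h.2.1.mul_left, hs.trans h.2.2⟩
  by_cases hx : x ∈ U
  · exact (ha.contDiffAt (hU.mem_nhds hx)).mul h.1.contDiffAt
  · have hx' : x ∉ tsupport (fun x => a x * φ x) := fun h' => hx (h.2.2 (hs h'))
    exact (contDiffAt_const (c := (0 : ℂ))).congr_of_eventuallyEq
      (notMem_tsupport_iff_eventuallyEq.1 hx')

theorem conj (h : IsTestFunction U φ) : IsTestFunction U (fun x => starRingEnd ℂ (φ x)) := by
  have hs : tsupport (fun x => starRingEnd ℂ (φ x)) ⊆ tsupport φ :=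
    tsupport_comp_subset (g := starRingEnd ℂ) (map_zero _) φ
  exact ⟨conjCLE.contDiff.comp h.1, h.2.1.comp_left (g := starRingEnd ℂ) (map_zero _),
    hs.trans h.2.2⟩

theorem mul (h : IsTestFunction U φ) (h' : IsTestFunction U ψ) :
    IsTestFunction U (fun x => φ x * ψ x) :=
  ⟨h.1.mul h'.1, h'.2.1.mul_left, tsupport_mul_subset_right.trans h'.2.2⟩

theorem mul_conj (h : IsTestFunction U φ) (h' : IsTestFunction U ψ) :
    IsTestFunction U (fun x => φ x * starRingEnd ℂ (ψ x)) :=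
  h.mul h'.conj

theorem fderiv_apply (h : IsTestFunction U φ) (e : EuclideanSpace ℝ (Fin n)) :
    IsTestFunction U (fun x => fderiv ℝ φ x e) :=
  ⟨(h.1.fderiv_right (m := ∞) (by simp)).clm_apply contDiff_const,
    h.2.1.fderiv_apply ℝ e, (tsupport_fderiv_apply_subset ℝ e).trans h.2.2⟩

end IsTestFunction

/-! ### Differential operators acting on test functions -/

namespace DiffOp

variable {n : ℕ} {U : Set (EuclideanSpace ℝ (Fin n))}

/-- All the coefficients of the expression `A` are smooth on `U`. -/
def SmoothCoeffsOn (U : Set (EuclideanSpace ℝ (Fin n))) : DiffOp n → Prop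
  | mul a => ContDiffOn ℝ ∞ a U
  | D _ => True
  | comp A B => A.SmoothCoeffsOn U ∧ B.SmoothCoeffsOn U
  | add A B => A.SmoothCoeffsOn U ∧ B.SmoothCoeffsOn U
  | sum _ A => ∀ j, (A j).SmoothCoeffsOn U

theorem adjoint_adjoint (A : DiffOp n) : A.adjoint.adjoint = A := by
  induction A with
  | mul a => simp [adjoint]
  | D l => rfl
  | comp A B hA hB => simp [adjoint, hA, hB]
  | add A B hA hB => simp [adjoint, hA, hB]
  | sum m A h => simp [adjoint, h]

theorem SmoothCoeffsOn.adjoint {A : DiffOp n} (h : A.SmoothCoeffsOn U) :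
    A.adjoint.SmoothCoeffsOn U := by
  induction A with
  | mul a => exact conjCLE.contDiff.comp_contDiffOn h
  | D l => trivial
  | comp A B hA hB => exact ⟨hB h.2, hA h.1⟩
  | add A B hA hB => exact ⟨hA h.1, hB h.2⟩
  | sum m A hA => exact fun j => hA j (h j)

theorem SmoothCoeffsOn.isTestFunction_apply (hU : IsOpen U) {A : DiffOp n}
    (h : A.SmoothCoeffsOn U) {φ : EuclideanSpace ℝ (Fin n) → ℂ} (hφ : IsTestFunction U φ) :
    IsTestFunction U (A.apply φ) := by
  induction A generalizing φ with
  | mul a => exact hφ.mul_left hU h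
  | D l => exact (hφ.fderiv_apply _).mul_left hU contDiffOn_const
  | comp A B hA hB => exact hA h.1 (hB h.2 hφ)
  | add A B hA hB => exact (hA h.1 hφ).add (hB h.2 hφ)
  | sum m A hA => exact IsTestFunction.sum fun j => hA j (h j) hφ

theorem SmoothCoeffsOn.apply_add (hU : IsOpen U) {A : DiffOp n}
    (h : A.SmoothCoeffsOn U) {φ ψ : EuclideanSpace ℝ (Fin n) → ℂ} (hφ : IsTestFunction U φ)
    (hψ : IsTestFunction U ψ) : A.apply (φ + ψ) = A.apply φ + A.apply ψ := by
  induction A generalizing φ ψ with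
  | mul a => ext x; simp [DiffOp.apply, mul_add]
  | D l =>
    ext x
    simp [DiffOp.apply, fderiv_add (hφ.differentiable x) (hψ.differentiable x), mul_add]
  | comp A B hA hB =>
    simp only [DiffOp.apply]
    rw [hB h.2 hφ hψ, hA h.1 (h.2.isTestFunction_apply hU hφ) (h.2.isTestFunction_apply hU hψ)]
  | add A B hA hB =>
    ext x
    simp only [DiffOp.apply, hA h.1 hφ hψ, hB h.2 hφ hψ, Pi.add_apply]
    ring
  | sum m A hA =>
    ext x
    simp only [DiffOp.apply, Pi.add_apply, ← Finset.sum_add_distrib]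
    exact Finset.sum_congr rfl fun j _ => by rw [hA j (h j) hφ hψ, Pi.add_apply]

theorem SmoothCoeffsOn.apply_smul (hU : IsOpen U) {A : DiffOp n}
    (h : A.SmoothCoeffsOn U) (z : ℂ) {φ : EuclideanSpace ℝ (Fin n) → ℂ}
    (hφ : IsTestFunction U φ) : A.apply (z • φ) = z • A.apply φ := by
  induction A generalizing φ with
  | mul a => ext x; simp [DiffOp.apply, mul_left_comm]
  | D l =>
    ext x
    simp [DiffOp.apply, fderiv_const_smul (hφ.differentiable x), mul_left_comm]
  | comp A B hA hB =>
    simp only [DiffOp.apply]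
    rw [hB h.2 hφ, hA h.1 (h.2.isTestFunction_apply hU hφ)]
  | add A B hA hB =>
    ext x
    simp only [DiffOp.apply, hA h.1 hφ, hB h.2 hφ, Pi.smul_apply, smul_add]
  | sum m A hA =>
    ext x
    simp only [DiffOp.apply, Pi.smul_apply, Finset.smul_sum]
    exact Finset.sum_congr rfl fun j _ => by rw [hA j (h j) hφ, Pi.smul_apply]

theorem fderiv_conj_apply {φ : EuclideanSpace ℝ (Fin n) → ℂ} (hφ : Differentiable ℝ φ)
    (x e : EuclideanSpace ℝ (Fin n)) :
    fderiv ℝ (fun y => starRingEnd ℂ (φ y)) x e = starRingEnd ℂ (fderiv ℝ φ x e) := by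
  have := (conjCLE.hasFDerivAt.comp x (hφ x).hasFDerivAt).fderiv
  exact congrArg (fun L => L e) this

/-- The formal adjoint is an adjoint on test functions. -/
theorem SmoothCoeffsOn.integral_apply_mul_conj (hU : IsOpen U) {A : DiffOp n}
    (h : A.SmoothCoeffsOn U) {φ ψ : EuclideanSpace ℝ (Fin n) → ℂ} (hφ : IsTestFunction U φ)
    (hψ : IsTestFunction U ψ) :
    ∫ x, A.apply φ x * starRingEnd ℂ (ψ x) = ∫ x, φ x * starRingEnd ℂ (A.adjoint.apply ψ x) := by
  induction A generalizing φ ψ with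
  | mul a =>
    refine integral_congr_ae (Filter.Eventually.of_forall fun x => ?_)
    simp only [DiffOp.apply, DiffOp.adjoint, map_mul, conj_conj]
    ring
  | D l =>
    have key := integral_mul_fderiv_eq_neg_fderiv_mul_of_integrable (μ := volume)
      (v := EuclideanSpace.single l (1 : ℝ)) ((hφ.fderiv_apply _).mul hψ.conj).integrable
      (hφ.mul (hψ.conj.fderiv_apply _)).integrable (hφ.mul hψ.conj).integrable
      (fun x _ => hφ.differentiable x) (fun x _ => hψ.conj.differentiable x)
    simp only [fderiv_conj_apply hψ.differentiable] at key
    simp only [DiffOp.apply, DiffOp.adjoint, map_mul, map_neg, conj_I, neg_neg]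
    simp only [mul_assoc, mul_left_comm _ I, integral_const_mul, key]
    ring
  | comp A B hA hB =>
    simp only [DiffOp.apply, DiffOp.adjoint]
    rw [hA h.1 (h.2.isTestFunction_apply hU hφ) hψ,
      hB h.2 hφ (h.1.adjoint.isTestFunction_apply hU hψ)]
  | add A B hA hB =>
    simp only [DiffOp.apply, DiffOp.adjoint, map_add, add_mul, mul_add]
    rw [integral_add ((h.1.isTestFunction_apply hU hφ).mul_conj hψ).integrable
        ((h.2.isTestFunction_apply hU hφ).mul_conj hψ).integrable,
      integral_add (hφ.mul_conj (h.1.adjoint.isTestFunction_apply hU hψ)).integrable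
        (hφ.mul_conj (h.2.adjoint.isTestFunction_apply hU hψ)).integrable,
      hA h.1 hφ hψ, hB h.2 hφ hψ]
  | sum m A hA =>
    simp only [DiffOp.apply, DiffOp.adjoint, map_sum, Finset.sum_mul, Finset.mul_sum]
    rw [integral_finsetSum _ fun j _ =>
        (((h j).isTestFunction_apply hU hφ).mul_conj hψ).integrable,
      integral_finsetSum _ fun j _ =>
        (hφ.mul_conj ((h j).adjoint.isTestFunction_apply hU hψ)).integrable]
    exact Finset.sum_congr rfl fun j _ => hA j (h j) hφ hψ

/-- The adjoint identity read from right to left. -/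
theorem SmoothCoeffsOn.integral_adjoint_apply_mul_conj (hU : IsOpen U) {A : DiffOp n}
    (h : A.SmoothCoeffsOn U) {φ ψ : EuclideanSpace ℝ (Fin n) → ℂ} (hφ : IsTestFunction U φ)
    (hψ : IsTestFunction U ψ) :
    ∫ x, A.adjoint.apply φ x * starRingEnd ℂ (ψ x) = ∫ x, φ x * starRingEnd ℂ (A.apply ψ x) := by
  simpa only [adjoint_adjoint] using h.adjoint.integral_apply_mul_conj hU hφ hψ

theorem smoothCoeffsOn_firstOrder {c : Fin n → EuclideanSpace ℝ (Fin n) → ℂ}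
    (hc : ∀ l, ContDiffOn ℝ ∞ (c l) U) : (firstOrder c).SmoothCoeffsOn U :=
  fun l => ⟨hc l, trivial⟩

end DiffOp

/-! ### From an a priori estimate to local solvability -/

/-- The complex vector space `C_0^∞(U)`. -/
def testFunctions {n : ℕ} (U : Set (EuclideanSpace ℝ (Fin n))) :
    Submodule ℂ (EuclideanSpace ℝ (Fin n) → ℂ) where
  carrier := {φ | IsTestFunction U φ}
  add_mem' := fun h h' => h.add h'
  zero_mem' := IsTestFunction.zero
  smul_mem' := fun z φ h =>
    ⟨contDiff_const.smul h.1, h.2.1.smul_left (f := fun _ => z),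
      (closure_mono (Function.support_const_smul_subset z φ)).trans h.2.2⟩

theorem norm_toLp_sq {α : Type*} [MeasurableSpace α] {μ : Measure α} {g : α → ℂ}
    (hg : MemLp g 2 μ) : ‖hg.toLp g‖ ^ 2 = ∫ x, ‖g x‖ ^ 2 ∂μ := by
  rw [← inner_self_eq_norm_sq (𝕜 := ℂ), L2.inner_def]
  have : ∫ x, inner ℂ (hg.toLp g x) (hg.toLp g x) ∂μ = ((∫ x, ‖g x‖ ^ 2 ∂μ : ℝ) : ℂ) := by
    rw [← integral_complex_ofReal]
    refine integral_congr_ae ?_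
    filter_upwards [hg.coeFn_toLp] with x hx
    rw [hx, inner_self_eq_norm_sq_to_K]
    simp
  rw [this]
  simp

/-- The duality argument: `P` is solvable in `L²` on `U` as soon as `P*` is bounded below on
`C_0^∞(U)`. -/
theorem L2LocallySolvableAt.of_estimate {n : ℕ} {Ω K : Set (EuclideanSpace ℝ (Fin n))}
    {x₀ : EuclideanSpace ℝ (Fin n)} (hK : IsCompact K) (hKΩ : K ⊆ Ω) (hx₀ : x₀ ∈ interior K)
    {P : DiffOp n} (hP : P.SmoothCoeffsOn (interior K)) {C : ℝ} (hC : 0 ≤ C)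
    (hest : ∀ φ, IsTestFunction (interior K) φ →
      ∫ x, ‖φ x‖ ^ 2 ≤ C ^ 2 * ∫ x, ‖P.adjoint.apply φ x‖ ^ 2) :
    L2LocallySolvableAt Ω P x₀ := by
  refine ⟨K, hK, hKΩ, hx₀, fun v hv => ?_⟩
  set U := interior K with hUdef
  have hU : IsOpen U := isOpen_interior
  have hPt : ∀ φ : testFunctions U, IsTestFunction U (P.adjoint.apply φ) := fun φ =>
    hP.adjoint.isTestFunction_apply hU φ.2
  have hvU : MemLp v 2 (volume.restrict U) :=
    (hv K hK hKΩ).mono_measure (Measure.restrict_mono interior_subset le_rfl)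
  let S : testFunctions U →ₗ[ℂ] Lp ℂ 2 (volume.restrict U) :=
    { toFun := fun φ => (IsTestFunction.memLp φ.2 (volume.restrict U)).toLp φ
      map_add' := fun φ ψ => MemLp.toLp_add _ _
      map_smul' := fun z φ => MemLp.toLp_const_smul z _ }
  let T : testFunctions U →ₗ[ℂ] Lp ℂ 2 (volume.restrict U) :=
    { toFun := fun φ => ((hPt φ).memLp (volume.restrict U)).toLp _
      map_add' := fun φ ψ => by
        rw [← MemLp.toLp_add]
        exact MemLp.toLp_congr _ _ (by
          rw [Submodule.coe_add, hP.adjoint.apply_add hU φ.2 ψ.2])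
      map_smul' := fun z φ => by
        rw [RingHom.id_apply, ← MemLp.toLp_const_smul]
        exact MemLp.toLp_congr _ _ (by
          rw [Submodule.coe_smul, hP.adjoint.apply_smul hU z φ.2]) }
  have hsq : ∀ φ, IsTestFunction U φ → ∫ x in U, ‖φ x‖ ^ 2 = ∫ x, ‖φ x‖ ^ 2 := fun φ hφ =>
    setIntegral_eq_integral_of_forall_compl_eq_zero fun x hx => by simp [hφ.eq_zero hx]
  have hST : ∀ φ, ‖S φ‖ ≤ C * ‖T φ‖ := fun φ => by
    refine le_of_sq_le_sq ?_ (by positivity)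
    rw [mul_pow]
    simp only [S, T, LinearMap.coe_mk, AddHom.coe_mk, norm_toLp_sq]
    rw [hsq _ φ.2, hsq _ (hPt φ)]
    exact hest _ φ.2
  let V : Lp ℂ 2 (volume.restrict U) := hvU.toLp v
  obtain ⟨u, hu⟩ := exists_inner_eq_of_norm_le T ((innerSL ℂ V).toLinearMap ∘ₗ S) (‖V‖ * C)
    fun φ => by
      calc ‖inner ℂ V (S φ)‖ ≤ ‖V‖ * ‖S φ‖ := norm_inner_le_norm _ _
        _ ≤ ‖V‖ * (C * ‖T φ‖) := by gcongr; exact hST φ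
        _ = ‖V‖ * C * ‖T φ‖ := by ring
  -- extended by zero outside `U`, the representative `u` is in `L²` globally
  refine ⟨U.indicator u, fun K' _ _ => ?_, fun φ hφ => ?_⟩
  · have : MemLp (U.indicator u) 2 volume :=
      (memLp_indicator_iff_restrict hU.measurableSet).2 (Lp.memLp u)
    exact this.restrict K'
  · have h1 : ∫ x in U, U.indicator u x * starRingEnd ℂ (P.adjoint.apply φ x)
        = starRingEnd ℂ (inner ℂ u (T ⟨φ, hφ⟩)) := by
      rw [L2.inner_def, ← integral_conj]
      refine integral_congr_ae ?_
      filter_upwards [((hPt ⟨φ, hφ⟩).memLp (volume.restrict U)).coeFn_toLp,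
        ae_restrict_mem hU.measurableSet] with x hx hxU
      simp only [T, LinearMap.coe_mk, AddHom.coe_mk]
      rw [hx, Set.indicator_of_mem hxU]
      simp [mul_comm]
    have h2 : ∫ x in U, v x * starRingEnd ℂ (φ x) = starRingEnd ℂ (inner ℂ V (S ⟨φ, hφ⟩)) := by
      rw [L2.inner_def, ← integral_conj]
      refine integral_congr_ae ?_
      filter_upwards [(IsTestFunction.memLp hφ (volume.restrict U)).coeFn_toLp,
        hvU.coeFn_toLp] with x hx hxv
      simp only [S, V, LinearMap.coe_mk, AddHom.coe_mk]
      rw [hx, hxv]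
      simp [mul_comm]
    rw [h1, h2, hu]
    rfl

namespace DiffOp

variable {n : ℕ} {U : Set (EuclideanSpace ℝ (Fin n))}

/-! ### Leibniz rules for first order operators -/

theorem firstOrder_apply_mul (c : Fin n → EuclideanSpace ℝ (Fin n) → ℂ)
    {g h : EuclideanSpace ℝ (Fin n) → ℂ} {x : EuclideanSpace ℝ (Fin n)}
    (hg : DifferentiableAt ℝ g x) (hh : DifferentiableAt ℝ h x) :
    (firstOrder c).apply (fun y => g y * h y) x
      = g x * (firstOrder c).apply h x + (firstOrder c).apply g x * h x := by
  simp only [firstOrder, DiffOp.apply, Finset.mul_sum, Finset.sum_mul, ← Finset.sum_add_distrib]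
  refine Finset.sum_congr rfl fun l _ => ?_
  rw [fderiv_fun_mul hg hh]
  simp
  ring

/-- The real vector field `∑ b_l ∂_l` acting on real functions. -/
noncomputable def vectorField (b : Fin n → EuclideanSpace ℝ (Fin n) → ℝ)
    (w : EuclideanSpace ℝ (Fin n) → ℝ) (x : EuclideanSpace ℝ (Fin n)) : ℝ :=
  ∑ l, b l x * fderiv ℝ w x (EuclideanSpace.single l 1)

/-- The divergence `∑ ∂_l b_l`. -/
noncomputable def divergence (b : Fin n → EuclideanSpace ℝ (Fin n) → ℝ)
    (x : EuclideanSpace ℝ (Fin n)) : ℝ :=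
  ∑ l, fderiv ℝ (b l) x (EuclideanSpace.single l 1)

/-- The real vector field `∑ b_l ∂_l = i ∑ b_l D_l` as a differential operator. -/
noncomputable def fieldOp (b : Fin n → EuclideanSpace ℝ (Fin n) → ℝ) : DiffOp n :=
  comp (mul fun _ => I) (firstOrder fun l x => (b l x : ℂ))

theorem differentiableAt_ofReal {w : EuclideanSpace ℝ (Fin n) → ℝ}
    {x : EuclideanSpace ℝ (Fin n)} (hw : DifferentiableAt ℝ w x) :
    DifferentiableAt ℝ (fun y => (w y : ℂ)) x :=
  ofRealCLM.differentiableAt.comp x hw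

theorem fderiv_ofReal_apply {w : EuclideanSpace ℝ (Fin n) → ℝ} {x : EuclideanSpace ℝ (Fin n)}
    (hw : DifferentiableAt ℝ w x) (e : EuclideanSpace ℝ (Fin n)) :
    fderiv ℝ (fun y => (w y : ℂ)) x e = (fderiv ℝ w x e : ℂ) := by
  have := (ofRealCLM.hasFDerivAt.comp x hw.hasFDerivAt).fderiv
  exact congrArg (fun L => L e) this

theorem fieldOp_apply (b : Fin n → EuclideanSpace ℝ (Fin n) → ℝ)
    (φ : EuclideanSpace ℝ (Fin n) → ℂ) (x : EuclideanSpace ℝ (Fin n)) :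
    (fieldOp b).apply φ x = ∑ l, (b l x : ℂ) * fderiv ℝ φ x (EuclideanSpace.single l 1) := by
  simp only [fieldOp, firstOrder, DiffOp.apply, Finset.mul_sum]
  refine Finset.sum_congr rfl fun l _ => ?_
  linear_combination -((b l x : ℂ) * fderiv ℝ φ x (EuclideanSpace.single l 1)) * I_sq

theorem fieldOp_apply_ofReal (b : Fin n → EuclideanSpace ℝ (Fin n) → ℝ)
    {w : EuclideanSpace ℝ (Fin n) → ℝ} {x : EuclideanSpace ℝ (Fin n)}
    (hw : DifferentiableAt ℝ w x) :
    (fieldOp b).apply (fun y => (w y : ℂ)) x = (vectorField b w x : ℂ) := by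
  simp [fieldOp_apply, fderiv_ofReal_apply hw, vectorField]

theorem fieldOp_apply_mul (b : Fin n → EuclideanSpace ℝ (Fin n) → ℝ)
    {w : EuclideanSpace ℝ (Fin n) → ℝ} {φ : EuclideanSpace ℝ (Fin n) → ℂ}
    {x : EuclideanSpace ℝ (Fin n)} (hw : DifferentiableAt ℝ w x)
    (hφ : DifferentiableAt ℝ φ x) :
    (fieldOp b).apply (fun y => (w y : ℂ) * φ y) x
      = w x * (fieldOp b).apply φ x + vectorField b w x * φ x := by
  rw [← fieldOp_apply_ofReal b hw]
  simp only [fieldOp, DiffOp.apply]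
  rw [firstOrder_apply_mul _ (differentiableAt_ofReal hw) hφ]
  ring

theorem fieldOp_adjoint_apply {b : Fin n → EuclideanSpace ℝ (Fin n) → ℝ}
    {φ : EuclideanSpace ℝ (Fin n) → ℂ} {x : EuclideanSpace ℝ (Fin n)}
    (hb : ∀ l, DifferentiableAt ℝ (b l) x) (hφ : DifferentiableAt ℝ φ x) :
    (fieldOp b).adjoint.apply φ x = -(fieldOp b).apply φ x - divergence b x * φ x := by
  rw [fieldOp_apply]
  simp only [fieldOp, firstOrder, DiffOp.adjoint, DiffOp.apply, divergence, ofReal_sum,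
    Finset.sum_mul, ← Finset.sum_neg_distrib, ← Finset.sum_sub_distrib]
  refine Finset.sum_congr rfl fun l _ => ?_
  have hb' : DifferentiableAt ℝ (fun y => starRingEnd ℂ (b l y : ℂ)) x := by
    simpa only [conj_ofReal] using differentiableAt_ofReal (hb l)
  rw [fderiv_fun_mul hb' (hφ.const_mul _), fderiv_const_mul hφ]
  simp only [conj_ofReal, conj_I, _root_.add_apply, _root_.smul_apply,
    smul_eq_mul, fderiv_ofReal_apply (hb l)]
  linear_combination ((b l x : ℂ) * fderiv ℝ φ x (EuclideanSpace.single l 1)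
    + fderiv ℝ (b l) x (EuclideanSpace.single l 1) * φ x) * I_sq

/-! ### The weighted energy estimate -/

/-- The transport part of the energy identity, before integration: the derivatives of `φ`
cancel because the vector field is real. -/
theorem re_fieldOp_symmetrized {b : Fin n → EuclideanSpace ℝ (Fin n) → ℝ}
    {w : EuclideanSpace ℝ (Fin n) → ℝ} {φ : EuclideanSpace ℝ (Fin n) → ℂ}
    {x : EuclideanSpace ℝ (Fin n)} (hb : ∀ l, DifferentiableAt ℝ (b l) x)
    (hw : DifferentiableAt ℝ w x) (hφ : DifferentiableAt ℝ φ x) :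
    ((fieldOp b).adjoint.apply φ x * starRingEnd ℂ ((w x : ℂ) * φ x)
      + φ x * starRingEnd ℂ ((fieldOp b).apply (fun y => (w y : ℂ) * φ y) x)).re
      = (vectorField b w x - w x * divergence b x) * ‖φ x‖ ^ 2 := by
  rw [fieldOp_adjoint_apply hb hφ, fieldOp_apply_mul b hw hφ, ← normSq_eq_norm_sq, normSq_apply]
  simp
  ring

/-- The degenerate elliptic part of the energy identity, before integration: completing the square
absorbs the derivatives of `φ`. -/
theorem re_mul_conj_ge {F w : ℝ} (hF : 0 ≤ F) (hw : 1 / 2 ≤ w) (Z Y s : ℂ) :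
    -(1 / 2 * F * ‖Y‖ ^ 2 * ‖s‖ ^ 2) ≤ ((F : ℂ) * Z * starRingEnd ℂ (w * Z + Y * s)).re := by
  have h1 : ((F : ℂ) * Z * starRingEnd ℂ (w * Z + Y * s)).re
      = F * (w * ‖Z‖ ^ 2 + (Z * starRingEnd ℂ (Y * s)).re) := by
    rw [← normSq_eq_norm_sq, normSq_apply]
    simp
    ring
  have h2 : -(‖Z‖ * (‖Y‖ * ‖s‖)) ≤ (Z * starRingEnd ℂ (Y * s)).re := by
    have := neg_le_of_abs_le (abs_re_le_norm (Z * starRingEnd ℂ (Y * s)))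
    simpa only [norm_mul, norm_conj] using this
  have h3 : 0 ≤ w * ‖Z‖ ^ 2 + (Z * starRingEnd ℂ (Y * s)).re + 1 / 2 * (‖Y‖ * ‖s‖) ^ 2 := by
    nlinarith [sq_nonneg (‖Z‖ - ‖Y‖ * ‖s‖), sq_nonneg ‖Z‖]
  rw [h1]
  nlinarith [mul_nonneg hF h3]

variable {N : ℕ} {p : ℕ} {c : Fin N → Fin n → EuclideanSpace ℝ (Fin n) → ℂ}
  {b : Fin n → EuclideanSpace ℝ (Fin n) → ℝ} {a₀ : EuclideanSpace ℝ (Fin n) → ℂ}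
  {f w : EuclideanSpace ℝ (Fin n) → ℝ}

theorem contDiffOn_ofReal {g : EuclideanSpace ℝ (Fin n) → ℝ} (hg : ContDiffOn ℝ ∞ g U) :
    ContDiffOn ℝ ∞ (fun x => (g x : ℂ)) U :=
  ofRealCLM.contDiff.comp_contDiffOn hg

theorem smoothCoeffsOn_fieldOp (hb : ∀ l, ContDiffOn ℝ ∞ (b l) U) :
    (fieldOp b).SmoothCoeffsOn U :=
  ⟨contDiffOn_const, smoothCoeffsOn_firstOrder fun l => contDiffOn_ofReal (hb l)⟩

theorem smoothCoeffsOn_mainClass (hc : ∀ j l, ContDiffOn ℝ ∞ (c j l) U)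
    (hb : ∀ l, ContDiffOn ℝ ∞ (b l) U) (ha₀ : ContDiffOn ℝ ∞ a₀ U) (hf : ContDiffOn ℝ ∞ f U) :
    (mainClass p c b a₀ f).SmoothCoeffsOn U :=
  ⟨⟨fun j => ⟨(smoothCoeffsOn_firstOrder (hc j)).adjoint, contDiffOn_ofReal (hf.pow p),
    smoothCoeffsOn_firstOrder (hc j)⟩, smoothCoeffsOn_fieldOp hb⟩, ha₀⟩

theorem mainClass_adjoint_apply (φ : EuclideanSpace ℝ (Fin n) → ℂ)
    (x : EuclideanSpace ℝ (Fin n)) :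
    (mainClass p c b a₀ f).adjoint.apply φ x
      = ∑ j, (firstOrder (c j)).adjoint.apply
          (fun y => ((f y ^ p : ℝ) : ℂ) * (firstOrder (c j)).apply φ y) x
        + (fieldOp b).adjoint.apply φ x + starRingEnd ℂ (a₀ x) * φ x := by
  have h : ∀ j, (firstOrder (c j)).adjoint.adjoint = firstOrder (c j) := fun j =>
    adjoint_adjoint _
  simp only [mainClass, DiffOp.adjoint, DiffOp.apply, h, conj_ofReal]
  rfl

/-- A function `q` with `Re (P* φ, w φ) ≥ ∫ q |φ|²` for `P = mainClass p c b a₀ f`, `p` even and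
`w ≥ 1 / 2`: the vector field contributes the first term, `a₀` the second, and the last one is the
price of completing the square in the second order part. -/
noncomputable def energyDensity (p : ℕ) (c : Fin N → Fin n → EuclideanSpace ℝ (Fin n) → ℂ)
    (b : Fin n → EuclideanSpace ℝ (Fin n) → ℝ) (a₀ : EuclideanSpace ℝ (Fin n) → ℂ)
    (f w : EuclideanSpace ℝ (Fin n) → ℝ) (x : EuclideanSpace ℝ (Fin n)) : ℝ :=
  1 / 2 * (vectorField b w x - w x * divergence b x) - ‖a₀ x‖ * w x
    - ∑ j, 1 / 2 * f x ^ p * ‖(firstOrder (c j)).apply (fun y => (w y : ℂ)) x‖ ^ 2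

/-- Where the weight is at least `1 / 2` and the energy density at least `1`, the quadratic form
`Re (P* φ, w φ)` controls the `L²` norm of `φ`. -/
theorem integral_norm_sq_le_re_adjoint (hU : IsOpen U) (hp : Even p)
    (hc : ∀ j l, ContDiffOn ℝ ∞ (c j l) U) (hb : ∀ l, ContDiffOn ℝ ∞ (b l) U)
    (ha₀ : ContDiffOn ℝ ∞ a₀ U) (hf : ContDiffOn ℝ ∞ f U) (hw : ContDiffOn ℝ ∞ w U)
    (hw₁ : ∀ x ∈ U, 1 / 2 ≤ w x) (hq : ∀ x ∈ U, 1 ≤ energyDensity p c b a₀ f w x)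
    {φ : EuclideanSpace ℝ (Fin n) → ℂ} (hφ : IsTestFunction U φ) :
    ∫ x, ‖φ x‖ ^ 2
      ≤ (∫ x, (mainClass p c b a₀ f).adjoint.apply φ x
          * starRingEnd ℂ ((w x : ℂ) * φ x)).re := by
  set ψ : EuclideanSpace ℝ (Fin n) → ℂ := fun x => (w x : ℂ) * φ x with hψdef
  have hψ : IsTestFunction U ψ := hφ.mul_left hU (contDiffOn_ofReal hw)
  set X : Fin N → DiffOp n := fun j => firstOrder (c j) with hX
  set B : DiffOp n := fieldOp b with hB
  have hXs : ∀ j, (X j).SmoothCoeffsOn U := fun j => smoothCoeffsOn_firstOrder (hc j)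
  have hBs : B.SmoothCoeffsOn U := smoothCoeffsOn_fieldOp hb
  set g : Fin N → EuclideanSpace ℝ (Fin n) → ℂ :=
    fun j y => ((f y ^ p : ℝ) : ℂ) * (X j).apply φ y with hgdef
  have hg : ∀ j, IsTestFunction U (g j) := fun j =>
    ((hXs j).isTestFunction_apply hU hφ).mul_left hU (contDiffOn_ofReal (hf.pow p))
  have hXg := fun j => ((hXs j).adjoint.isTestFunction_apply hU (hg j)).mul_conj hψ
  have hgX := fun j => (hg j).mul_conj ((hXs j).isTestFunction_apply hU hψ)
  have hBφ := (hBs.adjoint.isTestFunction_apply hU hφ).mul_conj hψ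
  have hφB := hφ.mul_conj (hBs.isTestFunction_apply hU hψ)
  have haφ := (hφ.mul_left hU (a := fun x => starRingEnd ℂ (a₀ x))
    (conjCLE.contDiff.comp_contDiffOn ha₀)).mul_conj hψ
  -- the pointwise form of the energy, after all integrations by parts
  set R : EuclideanSpace ℝ (Fin n) → ℂ := fun x =>
    ∑ j, g j x * starRingEnd ℂ ((X j).apply ψ x)
      + (1 / 2 : ℂ) * (B.adjoint.apply φ x * starRingEnd ℂ (ψ x)
          + φ x * starRingEnd ℂ (B.apply ψ x))
      + starRingEnd ℂ (a₀ x) * φ x * starRingEnd ℂ (ψ x) with hR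
  have hRt : IsTestFunction U R :=
    ((IsTestFunction.sum hgX).add ((hBφ.add hφB).mul_left hU contDiffOn_const)).add haφ
  have hint : ∫ x, (mainClass p c b a₀ f).adjoint.apply φ x * starRingEnd ℂ (ψ x) = ∫ x, R x := by
    simp only [mainClass_adjoint_apply, add_mul, Finset.sum_mul, hR]
    rw [integral_add ((IsTestFunction.sum hXg).add hBφ).integrable haφ.integrable,
      integral_add (IsTestFunction.sum hXg).integrable hBφ.integrable,
      integral_add ((IsTestFunction.sum hgX).add
        ((hBφ.add hφB).mul_left hU contDiffOn_const)).integrable haφ.integrable,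
      integral_add (IsTestFunction.sum hgX).integrable
        ((hBφ.add hφB).mul_left hU contDiffOn_const).integrable,
      integral_finsetSum _ fun j _ => (hXg j).integrable,
      integral_finsetSum _ fun j _ => (hgX j).integrable, integral_const_mul,
      integral_add hBφ.integrable hφB.integrable,
      ← hBs.integral_adjoint_apply_mul_conj hU hφ hψ,
      Finset.sum_congr rfl fun j _ => (hXs j).integral_adjoint_apply_mul_conj hU (hg j) hψ]
    ring
  rw [hint]
  have hre : (∫ x, R x).re = ∫ x, (R x).re := (integral_re hRt.integrable).symm
  rw [hre]
  refine integral_mono_of_nonneg (Filter.Eventually.of_forall fun x => by positivity)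
    hRt.integrable.re (Filter.Eventually.of_forall fun x => ?_)
  show ‖φ x‖ ^ 2 ≤ (R x).re
  by_cases hx : x ∈ U
  swap
  · simp [hφ.eq_zero hx, hRt.eq_zero hx]
  have hdiff : ∀ {v : EuclideanSpace ℝ (Fin n) → ℝ}, ContDiffOn ℝ ∞ v U →
      DifferentiableAt ℝ v x := fun hv =>
    (hv.contDiffAt (hU.mem_nhds hx)).differentiableAt (by simp)
  have h1 : ∀ j, -(1 / 2 * f x ^ p * ‖(X j).apply (fun y => (w y : ℂ)) x‖ ^ 2 * ‖φ x‖ ^ 2)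
      ≤ (g j x * starRingEnd ℂ ((X j).apply ψ x)).re := fun j => by
    rw [show (X j).apply ψ x = _ from firstOrder_apply_mul (c j)
      (differentiableAt_ofReal (hdiff hw)) (hφ.differentiable x)]
    exact re_mul_conj_ge (hp.pow_nonneg _) (hw₁ x hx) _ _ _
  have h2 := re_fieldOp_symmetrized (fun l => hdiff (hb l)) (hdiff hw) (hφ.differentiable x)
  have h3 : -(‖a₀ x‖ * w x * ‖φ x‖ ^ 2)
      ≤ (starRingEnd ℂ (a₀ x) * φ x * starRingEnd ℂ (ψ x)).re := by
    have hw0 : 0 ≤ w x := by linarith [hw₁ x hx]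
    have := neg_le_of_abs_le (abs_re_le_norm (starRingEnd ℂ (a₀ x) * φ x * starRingEnd ℂ (ψ x)))
    refine le_trans (le_of_eq ?_) this
    simp only [hψdef, norm_mul, norm_conj, norm_real, Real.norm_of_nonneg hw0]
    ring
  have h4 := Finset.sum_le_sum fun j (_ : j ∈ Finset.univ) => h1 j
  have h5 : (R x).re = ∑ j, (g j x * starRingEnd ℂ ((X j).apply ψ x)).re
      + 1 / 2 * (B.adjoint.apply φ x * starRingEnd ℂ (ψ x)
          + φ x * starRingEnd ℂ (B.apply ψ x)).re
      + (starRingEnd ℂ (a₀ x) * φ x * starRingEnd ℂ (ψ x)).re := by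
    simp only [hR, add_re, re_sum]
    congr 2
    rw [show (1 / 2 : ℂ) = ((1 / 2 : ℝ) : ℂ) by norm_num, re_ofReal_mul, add_re]
  have h6 := mul_le_mul_of_nonneg_right (hq x hx) (sq_nonneg ‖φ x‖)
  rw [energyDensity, sub_mul, Finset.sum_mul] at h6
  rw [Finset.sum_neg_distrib] at h4
  rw [h5, h2]
  linarith

/-- The a priori estimate: since `w ≤ 2`, the pointwise inequality `2 s t ≤ 2 s² + t² / 2` turns the
lower bound of the quadratic form into a lower bound of `P*`. -/
theorem integral_norm_sq_le (hU : IsOpen U) (hp : Even p)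
    (hc : ∀ j l, ContDiffOn ℝ ∞ (c j l) U) (hb : ∀ l, ContDiffOn ℝ ∞ (b l) U)
    (ha₀ : ContDiffOn ℝ ∞ a₀ U) (hf : ContDiffOn ℝ ∞ f U) (hw : ContDiffOn ℝ ∞ w U)
    (hw₁ : ∀ x ∈ U, 1 / 2 ≤ w x) (hw₂ : ∀ x ∈ U, w x ≤ 2)
    (hq : ∀ x ∈ U, 1 ≤ energyDensity p c b a₀ f w x)
    {φ : EuclideanSpace ℝ (Fin n) → ℂ} (hφ : IsTestFunction U φ) :
    ∫ x, ‖φ x‖ ^ 2 ≤ 2 ^ 2 * ∫ x, ‖(mainClass p c b a₀ f).adjoint.apply φ x‖ ^ 2 := by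
  have hP := (smoothCoeffsOn_mainClass (p := p) hc hb ha₀ hf).adjoint.isTestFunction_apply hU hφ
  have hψ : IsTestFunction U (fun x => (w x : ℂ) * φ x) := hφ.mul_left hU (contDiffOn_ofReal hw)
  have h0 := integral_norm_sq_le_re_adjoint hU hp hc hb ha₀ hf hw hw₁ hq hφ
  set G := (mainClass p c b a₀ f).adjoint.apply φ with hG
  have hφ2 : Integrable (fun x => ‖φ x‖ ^ 2) := (hφ.memLp volume).integrable_norm_pow (by simp)
  have hG2 : Integrable (fun x => ‖G x‖ ^ 2) := (hP.memLp volume).integrable_norm_pow (by simp)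
  have h1 : (∫ x, G x * starRingEnd ℂ ((w x : ℂ) * φ x)).re
      ≤ ∫ x, (2 * ‖G x‖ ^ 2 + 1 / 2 * ‖φ x‖ ^ 2) := by
    rw [show (∫ x, G x * starRingEnd ℂ ((w x : ℂ) * φ x)).re
      = ∫ x, (G x * starRingEnd ℂ ((w x : ℂ) * φ x)).re from
      (integral_re (hP.mul_conj hψ).integrable).symm]
    refine integral_mono (hP.mul_conj hψ).integrable.re
      ((hG2.const_mul 2).add (hφ2.const_mul (1 / 2))) fun x => ?_
    show (G x * starRingEnd ℂ ((w x : ℂ) * φ x)).re ≤ 2 * ‖G x‖ ^ 2 + 1 / 2 * ‖φ x‖ ^ 2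
    by_cases hx : x ∈ U
    swap
    · simp [hφ.eq_zero hx]
    have hw0 : 0 ≤ w x := by linarith [hw₁ x hx]
    have h2 : (G x * starRingEnd ℂ ((w x : ℂ) * φ x)).re ≤ ‖G x‖ * (w x * ‖φ x‖) := by
      refine (re_le_norm _).trans (le_of_eq ?_)
      simp only [norm_mul, norm_conj, norm_real, Real.norm_of_nonneg hw0]
    have h3 : ‖G x‖ * (w x * ‖φ x‖) ≤ ‖G x‖ * (2 * ‖φ x‖) := by
      gcongr
      exact hw₂ x hx
    nlinarith [sq_nonneg (2 * ‖G x‖ - ‖φ x‖)]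
  rw [integral_add (hG2.const_mul 2) (hφ2.const_mul (1 / 2)), integral_const_mul,
    integral_const_mul] at h1
  linarith

/-! ### Choice of the weight near a zero of `f` -/

theorem continuousOn_fderiv_apply {F : Type*} [NormedAddCommGroup F] [NormedSpace ℝ F]
    {g : EuclideanSpace ℝ (Fin n) → F} (hU : IsOpen U)
    (hg : ContDiffOn ℝ ∞ g U) (e : EuclideanSpace ℝ (Fin n)) :
    ContinuousOn (fun x => fderiv ℝ g x e) U :=
  (hg.continuousOn_fderiv_of_isOpen hU (by simp)).clm_apply continuousOn_const

theorem continuousOn_energyDensity {N p : ℕ} {c : Fin N → Fin n → EuclideanSpace ℝ (Fin n) → ℂ}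
    {b : Fin n → EuclideanSpace ℝ (Fin n) → ℝ} {a₀ : EuclideanSpace ℝ (Fin n) → ℂ}
    {f w : EuclideanSpace ℝ (Fin n) → ℝ} (hU : IsOpen U)
    (hc : ∀ j l, ContDiffOn ℝ ∞ (c j l) U) (hb : ∀ l, ContDiffOn ℝ ∞ (b l) U)
    (ha₀ : ContDiffOn ℝ ∞ a₀ U) (hf : ContDiffOn ℝ ∞ f U) (hw : ContDiffOn ℝ ∞ w U) :
    ContinuousOn (energyDensity p c b a₀ f w) U := by
  have hV : ContinuousOn (vectorField b w) U :=
    continuousOn_finsetSum _ fun l _ =>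
      (hb l).continuousOn.mul (continuousOn_fderiv_apply hU hw _)
  have hD : ContinuousOn (divergence b) U :=
    continuousOn_finsetSum _ fun l _ => continuousOn_fderiv_apply hU (hb l) _
  have hX : ∀ j, ContinuousOn ((firstOrder (c j)).apply (fun y => (w y : ℂ))) U := fun j =>
    continuousOn_finsetSum _ fun l _ => (hc j l).continuousOn.mul
      (continuousOn_const.mul (continuousOn_fderiv_apply hU (contDiffOn_ofReal hw) _))
  exact ((continuousOn_const.mul (hV.sub (hw.continuousOn.mul hD))).sub
    (ha₀.continuousOn.norm.mul hw.continuousOn)).sub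
    (continuousOn_finsetSum _ fun j _ =>
      (continuousOn_const.mul (hf.continuousOn.pow p)).mul ((hX j).norm.pow 2))

theorem vectorField_one_add_mul (b : Fin n → EuclideanSpace ℝ (Fin n) → ℝ)
    {f : EuclideanSpace ℝ (Fin n) → ℝ} {x : EuclideanSpace ℝ (Fin n)}
    (hf : DifferentiableAt ℝ f x) (t : ℝ) :
    vectorField b (fun y => 1 + t * f y) x = t * vectorField b f x := by
  simp only [vectorField, fderiv_const_add, fderiv_const_mul hf, Finset.mul_sum]
  refine Finset.sum_congr rfl fun l _ => ?_
  simp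
  ring

end DiffOp

end

theorem mainTheorem3 {n N : ℕ} (k : ℕ) (hk : 1 ≤ k)
    (Ω : Set (EuclideanSpace ℝ (Fin n))) (hΩ : IsOpen Ω)
    (c : Fin N → Fin n → EuclideanSpace ℝ (Fin n) → ℂ)
    (hc : ∀ j l, ContDiffOn ℝ ∞ (c j l) Ω)
    (b : Fin n → EuclideanSpace ℝ (Fin n) → ℝ)
    (hb : ∀ l, ContDiffOn ℝ ∞ (b l) Ω)
    (a₀ : EuclideanSpace ℝ (Fin n) → ℂ) (ha₀ : ContDiffOn ℝ ∞ a₀ Ω)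
    (f : EuclideanSpace ℝ (Fin n) → ℝ) (hf : ContDiffOn ℝ ∞ f Ω)
    (hX₀f : ∀ x ∈ Ω, f x = 0 →
      Complex.I * (DiffOp.firstOrder fun l y => (b l y : ℂ)).apply (fun y => (f y : ℂ)) x ≠ 0) :
    ∀ x₀ ∈ Ω, f x₀ = 0 →
      L2LocallySolvableAt Ω (DiffOp.mainClass (2 * k) c b a₀ f) x₀ := by
  intro x₀ hx₀ hfx₀
  have hΩx₀ : Ω ∈ nhds x₀ := hΩ.mem_nhds hx₀
  have hfd : DifferentiableAt ℝ f x₀ := (hf.contDiffAt hΩx₀).differentiableAt (by simp)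
  have hV : DiffOp.vectorField b f x₀ ≠ 0 := fun h =>
    hX₀f x₀ hx₀ hfx₀ ((DiffOp.fieldOp_apply_ofReal b hfd).trans (by rw [h, Complex.ofReal_zero]))
  -- `t` is chosen so that the weight `1 + t f` has energy density `2` at `x₀`; the second order
  -- part does not enter the computation because `f x₀ = 0` and `2 * k ≠ 0`
  set t : ℝ := (4 + DiffOp.divergence b x₀ + 2 * ‖a₀ x₀‖) / DiffOp.vectorField b f x₀ with ht
  set w : EuclideanSpace ℝ (Fin n) → ℝ := fun y => 1 + t * f y with hwdef
  have hw : ContDiffOn ℝ ∞ w Ω := contDiffOn_const.add (contDiffOn_const.mul hf)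
  have hwx₀ : w x₀ = 1 := by simp [hwdef, hfx₀]
  have hq₀ : DiffOp.energyDensity (2 * k) c b a₀ f w x₀ = 2 := by
    rw [DiffOp.energyDensity, DiffOp.vectorField_one_add_mul b hfd, hwx₀, ht,
      div_mul_cancel₀ _ hV, hfx₀, zero_pow (by omega)]
    simp
    ring
  have hqc := (DiffOp.continuousOn_energyDensity (p := 2 * k) hΩ hc hb ha₀ hf hw).continuousAt
    hΩx₀
  have hwc := hw.continuousOn.continuousAt hΩx₀
  have hlow : 1 / 2 < w x₀ := by rw [hwx₀]; norm_num
  have hupp : w x₀ < 2 := by rw [hwx₀]; norm_num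
  have hpos : 1 < DiffOp.energyDensity (2 * k) c b a₀ f w x₀ := by rw [hq₀]; norm_num
  have hnhds : ∀ᶠ x in nhds x₀, x ∈ Ω ∧ 1 < DiffOp.energyDensity (2 * k) c b a₀ f w x
      ∧ 1 / 2 < w x ∧ w x < 2 := by
    filter_upwards [hΩx₀, hqc.eventually_const_lt hpos, hwc.eventually_const_lt hlow,
      hwc.eventually_lt_const hupp] with x h1 h2 h3 h4
    exact ⟨h1, h2, h3, h4⟩
  obtain ⟨r, hr, hball⟩ := Metric.nhds_basis_closedBall.mem_iff.1 hnhds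
  set K := Metric.closedBall x₀ r with hKdef
  have hKΩ : K ⊆ Ω := fun x hx => (hball hx).1
  have hUΩ : interior K ⊆ Ω := interior_subset.trans hKΩ
  have hx₀K : x₀ ∈ interior K := Metric.ball_subset_interior_closedBall (Metric.mem_ball_self hr)
  have hc' := fun j l => (hc j l).mono hUΩ
  have hb' := fun l => (hb l).mono hUΩ
  exact L2LocallySolvableAt.of_estimate (isCompact_closedBall x₀ r) hKΩ hx₀K
    (DiffOp.smoothCoeffsOn_mainClass hc' hb' (ha₀.mono hUΩ) (hf.mono hUΩ)) (C := 2) (by norm_num)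
    fun φ hφ => DiffOp.integral_norm_sq_le isOpen_interior (even_two_mul k) hc' hb' (ha₀.mono hUΩ)
      (hf.mono hUΩ) (hw.mono hUΩ) (fun x hx => (hball (interior_subset hx)).2.2.1.le)
      (fun x hx => (hball (interior_subset hx)).2.2.2.le)
      (fun x hx => (hball (interior_subset hx)).2.1.le) hφ
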